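/- All manifolds, functions and tensor fields are of class $C^\infty$. Let $M$ be a Hausdorff manifold, let $Z$ be a vector field on $M$, and let $\pi_1,\pi_2$ be bivector fields on $M$ that define a Poisson pencil: $\pi_1$, $\pi_2$ and $\pi_\lambda:=\pi_1-\lambda\pi_2$, for every $\lambda\in\mathbb R$, are Poisson tensors, i.e. their Schouten--Nijenhuis bracket with themselves vanishes. Assume that the pencil is homogeneous with respect to $Z$, i.e. $[Z,\pi_\lambda]=-\pi_\lambda$ for every $\lambda\in\mathbb R$. Let $N$ be a (embedded or injectively immersed) submanifold of $M$ of codimension $1$ that is transverse to $Z$, i.e. $T_pM=T_pN+\mathbb R\,Z(p)$ for every $p\in N$. A Jacobi bracket on $N$ is an $\mathbb R$-bilinear, skew-symmetric map $\{\cdot,\cdot\}\colon C^\infty(N)\times C^\infty(N)\to C^\infty(N)$ that satisfies the Jacobi identity and is local, i.e. $\operatorname{supp}\{f,g\}\subseteq\operatorname{supp}f\cap\operatorname{supp}g$; by locality it also defines a bracket of functions on any open subset of $N$. Then there is a Jacobi pencil on $N$, i.e. there are Jacobi brackets $\{\cdot,\cdot\}_1$ and $\{\cdot,\cdot\}_2$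 on $N$ such that $\{\cdot,\cdot\}_\lambda:=\{\cdot,\cdot\}_1-\lambda\{\cdot,\cdot\}_2$ is a Jacobi bracket on $N$ for every $\lambda\in\mathbb R$, with the following property: for every open set $U\subseteq M$, all $f,g\in C^\infty(U)$ with $\langle Z,df\rangle=f$ and $\langle Z,dg\rangle=g$ on $U$, and every $\lambda\in\mathbb R$, $$\{f|_{N\cap U},\,g|_{N\cap U}\}_\lambda=\pi_\lambda(df,dg)|_{N\cap U}.$$ -/

import Mathlib

open scoped Manifold ContDiff Topology

noncomputable section

section Poisson

variable {E : Type*} [NormedAddCommGroup E] [NormedSpace ℝ E]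
  {H : Type*} [TopologicalSpace H] (I : ModelWithCorners ℝ E H)
  {M : Type*} [TopologicalSpace M] [ChartedSpace H M]

/-- A (not necessarily smooth) field of bilinear forms on the cotangent spaces `T*_x M`. -/
abbrev CotangentBilinField (M : Type*) [TopologicalSpace M] [ChartedSpace H M] : Type _ :=
  ∀ x : M, (TangentSpace I x →L[ℝ] ℝ) →ₗ[ℝ] (TangentSpace I x →L[ℝ] ℝ) →ₗ[ℝ] ℝ

variable {I}

/-- The function `x ↦ π_x(d_x f, d_x g)`. -/
def pairDiff (π : CotangentBilinField I M) (f g : M → ℝ) (x : M) : ℝ :=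
  π x (mvfderiv I f x) (mvfderiv I g x)

/-- `π` is a smooth bivector field: it is alternating at every point, and `π(df, dg)` is a smooth
function for all smooth functions `f`, `g` on `M` (as coordinate functions can be cut off by bump
functions, this says that the components of `π` in every chart are smooth). -/
structure IsBivectorField (π : CotangentBilinField I M) : Prop where
  alternating : ∀ (x : M) (α : TangentSpace I x →L[ℝ] ℝ), π x α α = 0
  smooth : ∀ f g : C^∞⟮I, M; ℝ⟯, ContMDiff I 𝓘(ℝ, ℝ) ∞ (pairDiff π f g)

/-- The derivative `⟨Z, df⟩` of a function along a vector field. -/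
def derivAlong (Z : ∀ x : M, TangentSpace I x) (f : M → ℝ) (x : M) : ℝ :=
  mvfderiv I f x (Z x)

/-- The value `[π, π](df, dg, dh)` of the Schouten–Nijenhuis bracket of the bivector field `π` with
itself, `2 (π(d π(df, dg), dh) + π(d π(dg, dh), df) + π(d π(dh, df), dg))`. A trivector field is
determined by its values on differentials of functions. -/
def schoutenSelf (π : CotangentBilinField I M) (f g h : M → ℝ) (x : M) : ℝ :=
  2 * (pairDiff π (pairDiff π f g) h x + pairDiff π (pairDiff π g h) f x
    + pairDiff π (pairDiff π h f) g x)

/-- The value `[Z, π](df, dg)` of the Schouten–Nijenhuis bracket (that is, the Lie derivative) of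
the bivector field `π` with the vector field `Z`,
`Z(π(df, dg)) - π(L_Z df, dg) - π(df, L_Z dg)`, where `L_Z df = d(Z f)`. -/
def schoutenVector (Z : ∀ x : M, TangentSpace I x) (π : CotangentBilinField I M)
    (f g : M → ℝ) (x : M) : ℝ :=
  derivAlong Z (pairDiff π f g) x - pairDiff π (derivAlong Z f) g x
    - pairDiff π f (derivAlong Z g) x

/-- `π` is a Poisson tensor: a smooth bivector field with `[π, π] = 0`. -/
structure IsPoissonTensor (π : CotangentBilinField I M) : Prop where
  bivector : IsBivectorField π
  schouten : ∀ (f g h : C^∞⟮I, M; ℝ⟯) (x : M), schoutenSelf π f g h x = 0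

/-- `π₁` and `π₂` are Poisson tensors and so is `π_c = π₁ - c π₂` for every real `c`. -/
structure IsPoissonPencil (π₁ π₂ : CotangentBilinField I M) : Prop where
  left : IsPoissonTensor π₁
  right : IsPoissonTensor π₂
  pencil : ∀ c : ℝ, IsPoissonTensor (π₁ - c • π₂)

/-- `[Z, π] = -π`. -/
def IsHomogeneousWrt (Z : ∀ x : M, TangentSpace I x) (π : CotangentBilinField I M) : Prop :=
  ∀ (f g : C^∞⟮I, M; ℝ⟯) (x : M), schoutenVector Z π f g x = -pairDiff π f g x

/-- The pencil `π_c = π₁ - c π₂` is homogeneous with respect to `Z`: `[Z, π_c] = -π_c` for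
every real `c`. -/
def IsHomogeneousPencil (Z : ∀ x : M, TangentSpace I x) (π₁ π₂ : CotangentBilinField I M) : Prop :=
  ∀ c : ℝ, IsHomogeneousWrt Z (π₁ - c • π₂)

/-- The map `ι` is transverse to the vector field `Z`: at every point of its source the
tangent space of the target is the sum of the image of `dι` and the line spanned by `Z`. -/
def IsTransverseTo {E' : Type*} [NormedAddCommGroup E'] [NormedSpace ℝ E']
    {H' : Type*} [TopologicalSpace H'] (J : ModelWithCorners ℝ E' H')
    {N : Type*} [TopologicalSpace N] [ChartedSpace H' N]
    (ι : N → M) (Z : ∀ x : M, TangentSpace I x) : Prop :=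
  ∀ p : N, LinearMap.range (mfderiv J I ι p : TangentSpace J p →ₗ[ℝ] TangentSpace I (ι p))
    ⊔ Submodule.span ℝ {Z (ι p)} = ⊤

end Poisson

section Jacobi

variable {E : Type*} [NormedAddCommGroup E] [NormedSpace ℝ E]
  {H : Type*} [TopologicalSpace H] {I : ModelWithCorners ℝ E H}
  {N : Type*} [TopologicalSpace N] [ChartedSpace H N]

/-- `B` is a Jacobi bracket on the manifold `N`: an `ℝ`-bilinear, skew-symmetric, local bracket on
`C^∞(N, ℝ)` that satisfies the Jacobi identity. -/
structure IsJacobiBracket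
    (B : C^∞⟮I, N; ℝ⟯ →ₗ[ℝ] C^∞⟮I, N; ℝ⟯ →ₗ[ℝ] C^∞⟮I, N; ℝ⟯) : Prop where
  skew : ∀ f g, B f g = -B g f
  jacobi : ∀ f g h, B f (B g h) + B g (B h f) + B h (B f g) = 0
  isLocal : ∀ f g, tsupport (B f g : N → ℝ) ⊆ tsupport (f : N → ℝ) ∩ tsupport (g : N → ℝ)

/-- `B₁` and `B₂` are Jacobi brackets and so is `B_c = B₁ - c B₂` for every real `c`. -/
structure IsJacobiPencil
    (B₁ B₂ : C^∞⟮I, N; ℝ⟯ →ₗ[ℝ] C^∞⟮I, N; ℝ⟯ →ₗ[ℝ] C^∞⟮I, N; ℝ⟯) : Prop where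
  left : IsJacobiBracket B₁
  right : IsJacobiBracket B₂
  pencil : ∀ c : ℝ, IsJacobiBracket (B₁ - c • B₂)

/-- The local bracket `B`, restricted to the open set `V`, satisfies `{f, g} = h` on `V`. A local
bracket acts on germs, so the value at `p` of the bracket of functions `f`, `g` that are smooth on
`V` only is the value at `p` of the bracket of any smooth functions `F`, `G` on all of `N` that
agree with `f`, `g` near `p`. -/
def LocalBracketEqOn
    (B : C^∞⟮I, N; ℝ⟯ →ₗ[ℝ] C^∞⟮I, N; ℝ⟯ →ₗ[ℝ] C^∞⟮I, N; ℝ⟯) (V : Set N) (f g h : N → ℝ) : Prop :=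
  ∀ p ∈ V, ∀ F G : C^∞⟮I, N; ℝ⟯, (F : N → ℝ) =ᶠ[𝓝 p] f → (G : N → ℝ) =ᶠ[𝓝 p] g →
    B F G p = h p

/-- The functions `F`, `G` in the preceding definition exist. -/
theorem exists_globalExtension_germ [FiniteDimensional ℝ E] [T2Space N] [IsManifold I ∞ N]
    {V : Set N} (hV : IsOpen V) {f : N → ℝ} (hf : ContMDiffOn I 𝓘(ℝ, ℝ) ∞ f V) {p : N}
    (hp : p ∈ V) : ∃ F : C^∞⟮I, N; ℝ⟯, (F : N → ℝ) =ᶠ[𝓝 p] f := by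
  obtain ⟨ρ, -, hρ⟩ := (SmoothBumpFunction.nhds_basis_tsupport (I := I) p).mem_iff.1
    (hV.mem_nhds hp)
  refine ⟨⟨fun q => ρ q * f q, ?_⟩, ?_⟩
  · refine contMDiff_of_tsupport (fun q hq => ?_)
    have hq' : q ∈ V := hρ ((closure_mono (Function.support_mul_subset_left _ _)) hq)
    exact ρ.contMDiffAt.mul (hf.contMDiffAt (hV.mem_nhds hq'))
  · filter_upwards [ρ.eventuallyEq_one] with q hq
    simp [hq]

end Jacobi

end

/-!
By transversality, the differential of `f` at a point of `N` is determined by `f|_N` and `Z f`.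
Hence for functions that are homogeneous of degree one along `Z`, the value of `π(df, dg)` at a
point of `N` depends only on `f|_N` and `g|_N`, and this is the bracket. No exact solutions of
`Z f = f` are needed: if `u` is a local equation of `N`, then `Z u ≠ 0` on `N`, and `Z f = f` can be
solved modulo `u ^ 2`. For such `f` and `g`, the equation `[Z, π] = -π` says that `π(df, dg)` is
again homogeneous of degree one to first order along `N`. It can therefore be inserted into the
bracket once more, and the Jacobi identity on `N` is `[π, π] = 0`.
-/

section Immersion

open Manifold IsManifold

variable {E : Type*} [NormedAddCommGroup E] [NormedSpace ℝ E]
  {H : Type*} [TopologicalSpace H] {I : ModelWithCorners ℝ E H}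
  {M : Type*} [TopologicalSpace M] [ChartedSpace H M]
  {E' : Type*} [NormedAddCommGroup E'] [NormedSpace ℝ E']
  {H' : Type*} [TopologicalSpace H'] {J : ModelWithCorners ℝ E' H'}
  {N : Type*} [TopologicalSpace N] [ChartedSpace H' N]
  {n : WithTop ℕ∞} {ι : N → M} {p : N}

theorem extend_codChart_apply_of_isImmersionAt (hι : IsImmersionAt J I n ι p) {q : N}
    (hq : q ∈ hι.domChart.source) :
    hι.codChart.extend I (ι q) = hι.equiv (hι.domChart.extend J q, 0) := by
  have hq' : q ∈ (hι.domChart.extend J).source := by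
    rwa [OpenPartialHomeomorph.extend_source]
  simpa only [Function.comp_apply, PartialEquiv.left_inv _ hq'] using
    hι.writtenInCharts (PartialEquiv.map_source _ hq')

theorem exists_local_retraction_of_isImmersionAt [J.Boundaryless] (hι : IsImmersionAt J I n ι p) :
    ∃ (V : Set M) (r : M → N), IsOpen V ∧ ι p ∈ V ∧ ContMDiffOn I J n r V ∧
      ∀ᶠ q in 𝓝 p, r (ι q) = q := by
  set φ := hι.domChart.extend J with hφ_def
  let proj : E →L[ℝ] E' :=
    (ContinuousLinearMap.fst ℝ E' hι.complement).comp (hι.equiv.symm : E →L[ℝ] E' × hι.complement)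
  let s : M → E' := fun x => proj (hι.codChart.extend I x)
  have hs : ContMDiffOn I 𝓘(ℝ, E') n s hι.codChart.source :=
    proj.contMDiff.comp_contMDiffOn
      (OpenPartialHomeomorph.contMDiffOn_extend hι.codChart_mem_maximalAtlas)
  have hsι : ∀ q ∈ hι.domChart.source, s (ι q) = φ q := fun q hq => by
    change proj (hι.codChart.extend I (ι q)) = φ q
    rw [extend_codChart_apply_of_isImmersionAt hι hq]
    simp [proj, hφ_def]
  have hφ_source : ∀ q ∈ hι.domChart.source, q ∈ φ.source := fun q hq => by
    rwa [OpenPartialHomeomorph.extend_source]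
  have hφ_symm : ContMDiffOn 𝓘(ℝ, E') J n φ.symm φ.target := by
    rw [OpenPartialHomeomorph.extend_target']
    exact contMDiffOn_extend_symm hι.domChart_mem_maximalAtlas
  refine ⟨hι.codChart.source ∩ s ⁻¹' φ.target, φ.symm ∘ s,
    hs.continuousOn.isOpen_inter_preimage hι.codChart.open_source
      hι.domChart.isOpen_extend_target, ⟨hι.mem_codChart_source, ?_⟩,
    hφ_symm.comp (hs.mono Set.inter_subset_left) Set.inter_subset_right, ?_⟩
  · rw [Set.mem_preimage, hsι p hι.mem_domChart_source]
    exact φ.map_source (hφ_source p hι.mem_domChart_source)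
  · filter_upwards [hι.domChart.open_source.mem_nhds hι.mem_domChart_source] with q hq
    rw [Function.comp_apply, hsι q hq, φ.left_inv (hφ_source q hq)]

theorem exists_contMDiffMap_comp_eventuallyEq_of_isImmersionAt [FiniteDimensional ℝ E] [T2Space M]
    [IsManifold I ∞ M] [J.Boundaryless] (hι : IsImmersionAt J I ∞ ι p) (F : C^∞⟮J, N; ℝ⟯) :
    ∃ f : C^∞⟮I, M; ℝ⟯, f ∘ ι =ᶠ[𝓝 p] F := by
  obtain ⟨V, r, hV, hpV, hr, hrι⟩ := exists_local_retraction_of_isImmersionAt hι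
  obtain ⟨f, hf⟩ := exists_globalExtension_germ hV (F.contMDiff.comp_contMDiffOn hr) hpV
  refine ⟨f, ?_⟩
  filter_upwards [hι.continuousAt.eventually hf, hrι] with q hfq hrq
  rw [Function.comp_apply, hfq, Function.comp_apply, hrq]

theorem surjective_mfderiv_extend [IsManifold I n M] (hn : n ≠ 0) {e : OpenPartialHomeomorph M H}
    (he : e ∈ maximalAtlas I n M) {x : M} (hx : x ∈ e.source) :
    Function.Surjective (mfderiv I 𝓘(ℝ, E) (e.extend I) x) := by
  have : IsManifold I 1 M := .of_le (ENat.one_le_iff_ne_zero_withTop.mpr hn)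
  have he' : e.MDifferentiable I I :=
    ⟨(contMDiffOn_of_mem_maximalAtlas he).mdifferentiableOn hn,
      (contMDiffOn_symm_of_mem_maximalAtlas he).mdifferentiableOn hn⟩
  have hd := (I.hasMFDerivAt (x := e x)).comp x (he'.mdifferentiableAt hx).hasMFDerivAt
  intro v
  obtain ⟨w, hw⟩ := he'.mfderiv_surjective hx v
  exact ⟨w, (DFunLike.congr_fun hd.mfderiv w).trans hw⟩

theorem nontrivial_complement_of_finrank_lt (hι : IsImmersionAt J I n ι p)
    (hdim : Module.finrank ℝ E' < Module.finrank ℝ E) : Nontrivial hι.complement := by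
  by_contra hsub
  rw [not_nontrivial_iff_subsingleton] at hsub
  have : Unique hι.complement := uniqueOfSubsingleton 0
  have hE : E' ≃ₗ[ℝ] E := LinearEquiv.prodUnique.symm.trans hι.equiv.toLinearEquiv
  exact hdim.ne hE.finrank_eq

theorem exists_contMDiffMap_vanishing_of_isImmersionAt [FiniteDimensional ℝ E] [T2Space M]
    [IsManifold I ∞ M] (hι : IsImmersionAt J I ∞ ι p)
    (hdim : Module.finrank ℝ E' < Module.finrank ℝ E) :
    ∃ u : C^∞⟮I, M; ℝ⟯, (∀ᶠ q in 𝓝 p, u (ι q) = 0) ∧ mvfderiv I u (ι p) ≠ 0 := by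
  set ψ := hι.codChart.extend I
  have := nontrivial_complement_of_finrank_lt hι hdim
  obtain ⟨v, hv⟩ := exists_ne (0 : hι.complement)
  obtain ⟨ℓ, hℓ⟩ := SeparatingDual.exists_ne_zero (R := ℝ) hv
  let L : E →L[ℝ] ℝ := (ℓ.comp (ContinuousLinearMap.snd ℝ E' hι.complement)).comp
    (hι.equiv.symm : E →L[ℝ] E' × hι.complement)
  have hψ : ContMDiffOn I 𝓘(ℝ, E) ∞ ψ hι.codChart.source :=
    OpenPartialHomeomorph.contMDiffOn_extend hι.codChart_mem_maximalAtlas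
  obtain ⟨u, hu⟩ := exists_globalExtension_germ hι.codChart.open_source
    (L.contMDiff.comp_contMDiffOn hψ) hι.mem_codChart_source
  refine ⟨u, ?_, fun hdu => ?_⟩
  · filter_upwards [hι.continuousAt.eventually hu,
      hι.domChart.open_source.mem_nhds hι.mem_domChart_source] with q huq hq
    rw [huq, Function.comp_apply, extend_codChart_apply_of_isImmersionAt hι hq]
    simp [L]
  · obtain ⟨w, hw⟩ := surjective_mfderiv_extend (by simp) hι.codChart_mem_maximalAtlas
      hι.mem_codChart_source (hι.equiv (0, v))
    have hψp : MDifferentiableAt I 𝓘(ℝ, E) ψ (ι p) :=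
      (hψ.contMDiffAt (hι.codChart.open_source.mem_nhds hι.mem_codChart_source)).mdifferentiableAt
        (by simp)
    have hduw : mvfderiv I u (ι p) w = L (mfderiv I 𝓘(ℝ, E) ψ (ι p) w) := by
      rw [show mvfderiv I u (ι p) = mvfderiv I (L ∘ ψ) (ι p) from hu.mfderiv_eq,
        mvfderiv_comp_apply _ L.mdifferentiableAt hψp, mvfderiv, mfderiv_eq_fderiv, L.fderiv]
      rfl
    apply hℓ
    calc ℓ v = L (hι.equiv (0, v)) := by simp [L]
      _ = mvfderiv I u (ι p) w := by rw [hduw, hw]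
      _ = 0 := by rw [hdu]; rfl

end Immersion

section Derivation

variable {K A : Type*} [Field K] [CharZero K] [CommRing A] [Algebra K A]

/- Newton-like iteration: adding `u ^ (m + 1) * v` changes the residual by
`(m + 1) * u ^ m * v * D u` modulo `u ^ (m + 1)`, so the term of order `m` is removed by
`v = -k w / (m + 1)`, where `w` is an inverse of `D u` up to the error `w * D u - 1`. -/
theorem exists_derivation_eq_mul_mod_pow (D : Derivation K A A) (c f₀ u w : A) (m : ℕ) :
    ∃ a b k : A, D (f₀ + u * a) = c * (f₀ + u * a) + (w * D u - 1) * b + u ^ m * k := by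
  induction m with
  | zero => exact ⟨0, 0, D f₀ - c * f₀, by simp⟩
  | succ m ih =>
    obtain ⟨a, b, k, h⟩ := ih
    set v : A := (-(m + 1 : K)⁻¹) • (k * w) with hv_def
    have hv : (m + 1 : A) * v = -(k * w) := by
      have hm : (m + 1 : K) ≠ 0 := by exact_mod_cast m.succ_ne_zero
      have hcast : (m + 1 : A) = algebraMap K A (m + 1) := by simp
      rw [hv_def, hcast, ← Algebra.smul_def, smul_smul, mul_neg, mul_inv_cancel₀ hm, neg_one_smul]
    have hD : D (u ^ (m + 1) * v) = u ^ (m + 1) * D v + (m + 1 : A) * v * u ^ m * D u := by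
      simp only [Derivation.leibniz, Derivation.leibniz_pow, smul_eq_mul, nsmul_eq_mul,
        Nat.cast_add, Nat.cast_one, Nat.add_sub_cancel]
      ring
    refine ⟨a + u ^ m * v, b - u ^ m * k, D v - c * v, ?_⟩
    rw [show f₀ + u * (a + u ^ m * v) = f₀ + u * a + u ^ (m + 1) * v by ring, map_add, h, hD, hv]
    ring

end Derivation

section HomogeneousExtension

variable {E : Type*} [NormedAddCommGroup E] [NormedSpace ℝ E]
  {H : Type*} [TopologicalSpace H] {I : ModelWithCorners ℝ E H}
  {M : Type*} [TopologicalSpace M] [ChartedSpace H M]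
  {E' : Type*} [NormedAddCommGroup E'] [NormedSpace ℝ E']
  {H' : Type*} [TopologicalSpace H'] {J : ModelWithCorners ℝ E' H'}
  {N : Type*} [TopologicalSpace N] [ChartedSpace H' N]
  {Z : ∀ x : M, TangentSpace I x} {ι : N → M}

theorem mdifferentiableAt_of_contMDiffMap (f : C^∞⟮I, M; ℝ⟯) (x : M) :
    MDifferentiableAt I 𝓘(ℝ, ℝ) f x :=
  (f.contMDiff x).mdifferentiableAt (by simp)

theorem mvfderiv_const_smul {f : M → ℝ} {x : M} (hf : MDifferentiableAt I 𝓘(ℝ, ℝ) f x) (c : ℝ) :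
    mvfderiv I (c • f) x = c • mvfderiv I f x :=
  (hf.hasMFDerivAt.const_smul c).mfderiv

theorem contMDiff_derivAlong [IsManifold I ∞ M]
    (hZ : ContMDiff I I.tangent ∞ (fun x => (⟨x, Z x⟩ : TangentBundle I M)))
    (f : C^∞⟮I, M; ℝ⟯) : ContMDiff I 𝓘(ℝ, ℝ) ∞ (derivAlong Z f) :=
  (contMDiff_snd_tangentBundle_modelSpace ℝ 𝓘(ℝ, ℝ)).comp
    ((f.contMDiff.contMDiff_tangentMap (m := ∞) (by simp)).comp hZ)

/-- A smooth vector field acting as a derivation on the algebra of smooth functions. -/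
noncomputable def derivAlongDerivation [IsManifold I ∞ M]
    (hZ : ContMDiff I I.tangent ∞ (fun x => (⟨x, Z x⟩ : TangentBundle I M))) :
    Derivation ℝ C^∞⟮I, M; ℝ⟯ C^∞⟮I, M; ℝ⟯ :=
  Derivation.mk'
    { toFun f := ⟨derivAlong Z f, contMDiff_derivAlong hZ f⟩
      map_add' f g := by
        ext x
        exact DFunLike.congr_fun (mvfderiv_add (mdifferentiableAt_of_contMDiffMap f x)
          (mdifferentiableAt_of_contMDiffMap g x)) (Z x)
      map_smul' c f := by
        ext x
        exact DFunLike.congr_fun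
          (mvfderiv_const_smul (mdifferentiableAt_of_contMDiffMap f x) c) (Z x) }
    fun f g => by
      ext x
      exact DFunLike.congr_fun (mvfderiv_mul (mdifferentiableAt_of_contMDiffMap f x)
        (mdifferentiableAt_of_contMDiffMap g x)) (Z x)

theorem exists_derivAlong_eventuallyEq_add_pow_mul [FiniteDimensional ℝ E] [T2Space M]
    [IsManifold I ∞ M]
    (hZ : ContMDiff I I.tangent ∞ (fun x => (⟨x, Z x⟩ : TangentBundle I M)))
    (f₀ u : C^∞⟮I, M; ℝ⟯) {x : M} (hu : derivAlong Z u x ≠ 0) (m : ℕ) :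
    ∃ a k : C^∞⟮I, M; ℝ⟯, derivAlong Z (f₀ + u * a : C^∞⟮I, M; ℝ⟯) =ᶠ[𝓝 x]
      (f₀ + u * a + u ^ m * k : C^∞⟮I, M; ℝ⟯) := by
  let D := derivAlongDerivation hZ
  have hV : IsOpen {y | D u y ≠ 0} := isOpen_ne_fun (D u).contMDiff.continuous continuous_const
  obtain ⟨w, hw⟩ : ∃ w : C^∞⟮I, M; ℝ⟯, (w : M → ℝ) =ᶠ[𝓝 x] fun y => (D u y)⁻¹ :=
    exists_globalExtension_germ hV
      (fun y hy => ((D u).contMDiff y).contMDiffWithinAt.inv₀ hy) hu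
  obtain ⟨a, b, k, h⟩ := exists_derivation_eq_mul_mod_pow D 1 f₀ u w m
  refine ⟨a, k, ?_⟩
  filter_upwards [hw, hV.mem_nhds hu] with y hwy hy
  have hwDu : w y * D u y = 1 := by rw [hwy, inv_mul_cancel₀ hy]
  have hDy := DFunLike.congr_fun h y
  simp only [ContMDiffMap.coe_add, ContMDiffMap.coe_mul, ContMDiffMap.coe_sub,
    ContMDiffMap.coe_one, Pi.add_apply, Pi.mul_apply, Pi.sub_apply, Pi.one_apply, hwDu] at hDy ⊢
  refine hDy.trans ?_
  ring

theorem mvfderiv_eq_of_isTransverseTo (htr : IsTransverseTo J ι Z) {p : N}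
    (hι : MDifferentiableAt J I ι p) {f g : M → ℝ}
    (hf : MDifferentiableAt I 𝓘(ℝ, ℝ) f (ι p)) (hg : MDifferentiableAt I 𝓘(ℝ, ℝ) g (ι p))
    (hfg : f ∘ ι =ᶠ[𝓝 p] g ∘ ι) (hZ : derivAlong Z f (ι p) = derivAlong Z g (ι p)) :
    mvfderiv I f (ι p) = mvfderiv I g (ι p) := by
  have hd : mvfderiv J (f ∘ ι) p = mvfderiv J (g ∘ ι) p := hfg.mfderiv_eq
  rw [mvfderiv_comp p hf hι, mvfderiv_comp p hg hι] at hd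
  have hle : (⊤ : Submodule ℝ (TangentSpace I (ι p))) ≤
      LinearMap.eqLocus (mvfderiv I f (ι p) : TangentSpace I (ι p) →ₗ[ℝ] ℝ)
        (mvfderiv I g (ι p) : TangentSpace I (ι p) →ₗ[ℝ] ℝ) := by
    rw [← htr p, sup_le_iff, Submodule.span_singleton_le_iff_mem]
    refine ⟨?_, hZ⟩
    rintro _ ⟨v, rfl⟩
    exact DFunLike.congr_fun hd v
  ext v
  exact hle (Submodule.mem_top : v ∈ ⊤)

theorem derivAlong_ne_zero_of_isTransverseTo (htr : IsTransverseTo J ι Z) {p : N}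
    (hι : MDifferentiableAt J I ι p) {u : M → ℝ} (hu : MDifferentiableAt I 𝓘(ℝ, ℝ) u (ι p))
    (hu_zero : ∀ᶠ q in 𝓝 p, u (ι q) = 0) (hdu : mvfderiv I u (ι p) ≠ 0) :
    derivAlong Z u (ι p) ≠ 0 := by
  intro hZu
  have h := mvfderiv_eq_of_isTransverseTo (g := 0) htr hι hu mdifferentiableAt_const hu_zero
    (by rw [hZu]; simp [derivAlong])
  exact hdu (h.trans mvfderiv_zero)

variable (Z ι) in
/-- To first order at `ι p`, the function `f` is homogeneous of degree one along `Z`, and it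
restricts along `ι` to the germ of `F` at `p`. -/
structure IsHomogeneousExtensionAt (F : N → ℝ) (p : N) (f : M → ℝ) : Prop where
  mdifferentiableAt : MDifferentiableAt I 𝓘(ℝ, ℝ) f (ι p)
  comp_eventuallyEq : f ∘ ι =ᶠ[𝓝 p] F
  derivAlong_eq : derivAlong Z f (ι p) = f (ι p)

namespace IsHomogeneousExtensionAt

variable {F G : N → ℝ} {p : N} {f g : M → ℝ}

theorem congr (hf : IsHomogeneousExtensionAt Z ι F p f) (h : F =ᶠ[𝓝 p] G) :
    IsHomogeneousExtensionAt Z ι G p f :=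
  ⟨hf.mdifferentiableAt, hf.comp_eventuallyEq.trans h, hf.derivAlong_eq⟩

theorem zero : IsHomogeneousExtensionAt Z ι (0 : N → ℝ) p (0 : M → ℝ) where
  mdifferentiableAt := mdifferentiableAt_const
  comp_eventuallyEq := .rfl
  derivAlong_eq := by simp [derivAlong]

theorem add (hf : IsHomogeneousExtensionAt Z ι F p f) (hg : IsHomogeneousExtensionAt Z ι G p g) :
    IsHomogeneousExtensionAt Z ι (F + G) p (f + g) where
  mdifferentiableAt := hf.mdifferentiableAt.add hg.mdifferentiableAt
  comp_eventuallyEq := hf.comp_eventuallyEq.add hg.comp_eventuallyEq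
  derivAlong_eq := by
    rw [derivAlong, mvfderiv_add hf.mdifferentiableAt hg.mdifferentiableAt, Pi.add_apply,
      ← hf.derivAlong_eq, ← hg.derivAlong_eq]
    rfl

theorem const_smul (hf : IsHomogeneousExtensionAt Z ι F p f) (c : ℝ) :
    IsHomogeneousExtensionAt Z ι (c • F) p (c • f) where
  mdifferentiableAt := hf.mdifferentiableAt.const_smul c
  comp_eventuallyEq := hf.comp_eventuallyEq.const_smul c
  derivAlong_eq := by
    rw [derivAlong, mvfderiv_const_smul hf.mdifferentiableAt, Pi.smul_apply, ← hf.derivAlong_eq]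
    rfl

theorem mvfderiv_eq (htr : IsTransverseTo J ι Z) (hι : MDifferentiableAt J I ι p)
    (hf : IsHomogeneousExtensionAt Z ι F p f) (hg : IsHomogeneousExtensionAt Z ι F p g) :
    mvfderiv I f (ι p) = mvfderiv I g (ι p) := by
  have hfg := hf.comp_eventuallyEq.trans hg.comp_eventuallyEq.symm
  refine mvfderiv_eq_of_isTransverseTo htr hι hf.mdifferentiableAt hg.mdifferentiableAt hfg ?_
  rw [hf.derivAlong_eq, hg.derivAlong_eq]
  exact hfg.eq_of_nhds

end IsHomogeneousExtensionAt

variable (Z ι) in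
/-- The function `f` extends the germ of `F` at `p`, and it solves `Z f = f` to second order at
`ι p`: the equation holds on the image of `ι` near `p`, and its differential holds at `ι p`. -/
structure IsSecondOrderHomogeneousExtensionAt (F : N → ℝ) (p : N) (f : M → ℝ) : Prop where
  eventually : ∀ᶠ q in 𝓝 p, IsHomogeneousExtensionAt Z ι F q f
  mvfderiv_derivAlong : mvfderiv I (derivAlong Z f) (ι p) = mvfderiv I f (ι p)

theorem IsSecondOrderHomogeneousExtensionAt.isHomogeneousExtensionAt {F : N → ℝ} {p : N}
    {f : M → ℝ} (hf : IsSecondOrderHomogeneousExtensionAt Z ι F p f) :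
    IsHomogeneousExtensionAt Z ι F p f :=
  hf.eventually.self_of_nhds

variable (J Z ι) in
/-- Every smooth function on the source of `ι` has, at every point, a smooth extension along `ι`
that is homogeneous of degree one along `Z` to second order. -/
def HasHomogeneousExtensions : Prop :=
  ∀ (F : C^∞⟮J, N; ℝ⟯) (p : N),
    ∃ f : C^∞⟮I, M; ℝ⟯, IsSecondOrderHomogeneousExtensionAt Z ι F p f

theorem isSecondOrderHomogeneousExtensionAt_of_eventuallyEq_add_sq_mul {F : N → ℝ} {p : N}
    {f u k : C^∞⟮I, M; ℝ⟯} (hι : ContinuousAt ι p) (hfF : f ∘ ι =ᶠ[𝓝 p] F)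
    (hu : ∀ᶠ q in 𝓝 p, u (ι q) = 0)
    (hf : derivAlong Z f =ᶠ[𝓝 (ι p)] (f + u ^ 2 * k : C^∞⟮I, M; ℝ⟯)) :
    IsSecondOrderHomogeneousExtensionAt Z ι F p f where
  eventually := by
    filter_upwards [hfF.eventuallyEq_nhds, hι.eventually hf, hu] with q hfFq hfq huq
    refine ⟨mdifferentiableAt_of_contMDiffMap f _, hfFq, hfq.trans ?_⟩
    simp [huq]
  mvfderiv_derivAlong := by
    have hdf : mvfderiv I (derivAlong Z f) (ι p) =
        mvfderiv I (f + u ^ 2 * k : C^∞⟮I, M; ℝ⟯) (ι p) := hf.mfderiv_eq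
    have hu' := mdifferentiableAt_of_contMDiffMap u (ι p)
    have hk := mdifferentiableAt_of_contMDiffMap k (ι p)
    rw [hdf, sq, ContMDiffMap.coe_add, ContMDiffMap.coe_mul, ContMDiffMap.coe_mul,
      mvfderiv_add (mdifferentiableAt_of_contMDiffMap f _) ((hu'.mul hu').mul hk),
      mvfderiv_mul (hu'.mul hu') hk, mvfderiv_mul hu' hu']
    simp [hu.self_of_nhds]

theorem hasHomogeneousExtensions_of_isImmersion [FiniteDimensional ℝ E] [T2Space M]
    [IsManifold I ∞ M] [J.Boundaryless]
    (hZ : ContMDiff I I.tangent ∞ (fun x => (⟨x, Z x⟩ : TangentBundle I M)))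
    (hι : Manifold.IsImmersion J I ∞ ι) (hdim : Module.finrank ℝ E' < Module.finrank ℝ E)
    (htr : IsTransverseTo J ι Z) : HasHomogeneousExtensions J Z ι := by
  intro F p
  obtain ⟨f₀, hf₀⟩ := exists_contMDiffMap_comp_eventuallyEq_of_isImmersionAt
    (hι.isImmersionAt p) F
  obtain ⟨u, hu, hdu⟩ := exists_contMDiffMap_vanishing_of_isImmersionAt (hι.isImmersionAt p) hdim
  have hZu := derivAlong_ne_zero_of_isTransverseTo htr
    ((hι.contMDiff p).mdifferentiableAt (by simp)) (mdifferentiableAt_of_contMDiffMap u _) hu hdu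
  obtain ⟨a, k, hfk⟩ := exists_derivAlong_eventuallyEq_add_pow_mul hZ f₀ u hZu 2
  refine ⟨f₀ + u * a, isSecondOrderHomogeneousExtensionAt_of_eventuallyEq_add_sq_mul
    (hι.contMDiff p).continuousAt ?_ hu hfk⟩
  filter_upwards [hf₀, hu] with q hf₀q huq
  simpa [huq] using hf₀q

end HomogeneousExtension

section InducedBracket

variable {E : Type*} [NormedAddCommGroup E] [NormedSpace ℝ E]
  {H : Type*} [TopologicalSpace H] {I : ModelWithCorners ℝ E H}
  {M : Type*} [TopologicalSpace M] [ChartedSpace H M]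
  {E' : Type*} [NormedAddCommGroup E'] [NormedSpace ℝ E']
  {H' : Type*} [TopologicalSpace H'] {J : ModelWithCorners ℝ E' H'}
  {N : Type*} [TopologicalSpace N] [ChartedSpace H' N]
  {Z : ∀ x : M, TangentSpace I x} {ι : N → M}

theorem pairDiff_congr (π : CotangentBilinField I M) {f f' g g' : M → ℝ} {x : M}
    (hf : mvfderiv I f x = mvfderiv I f' x) (hg : mvfderiv I g x = mvfderiv I g' x) :
    pairDiff π f g x = pairDiff π f' g' x := by
  rw [pairDiff, pairDiff, hf, hg]

theorem pairDiff_sub_smul (π₁ π₂ : CotangentBilinField I M) (c : ℝ) (f g : M → ℝ) :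
    pairDiff (π₁ - c • π₂) f g = pairDiff π₁ f g - c • pairDiff π₂ f g :=
  rfl

theorem IsBivectorField.pairDiff_swap {π : CotangentBilinField I M} (hπ : IsBivectorField π)
    (f g : M → ℝ) (x : M) : pairDiff π f g x = -pairDiff π g f x :=
  (LinearMap.IsAlt.neg (hπ.alternating x) _ _).symm

theorem IsBivectorField.mdifferentiableAt_pairDiff {π : CotangentBilinField I M}
    (hπ : IsBivectorField π) (f g : C^∞⟮I, M; ℝ⟯) (x : M) :
    MDifferentiableAt I 𝓘(ℝ, ℝ) (pairDiff π f g) x :=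
  (hπ.smooth f g x).mdifferentiableAt (by simp)

theorem exists_linearMap_eq_mvfderiv (hext : HasHomogeneousExtensions J Z ι)
    (htr : IsTransverseTo J ι Z) {p : N} (hι : MDifferentiableAt J I ι p) :
    ∃ α : C^∞⟮J, N; ℝ⟯ →ₗ[ℝ] (TangentSpace I (ι p) →L[ℝ] ℝ),
      ∀ (F : C^∞⟮J, N; ℝ⟯) (f : M → ℝ), IsHomogeneousExtensionAt Z ι F p f →
        α F = mvfderiv I f (ι p) := by
  choose f hf₂ using fun F => hext F p
  have hf := fun F => (hf₂ F).isHomogeneousExtensionAt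
  refine ⟨{ toFun F := mvfderiv I (f F) (ι p), map_add' F G := ?_, map_smul' c F := ?_ },
    fun F g hg => (hf F).mvfderiv_eq htr hι hg⟩
  · rw [(hf (F + G)).mvfderiv_eq htr hι ((hf F).add (hf G)),
      mvfderiv_add (hf F).mdifferentiableAt (hf G).mdifferentiableAt]
  · rw [(hf (c • F)).mvfderiv_eq htr hι ((hf F).const_smul c),
      mvfderiv_const_smul (hf F).mdifferentiableAt, RingHom.id_apply]

variable (Z ι) in
/-- The bracket `B` on the source of `ι` is the restriction of `π` to functions that are
homogeneous of degree one along `Z`. Only first-order homogeneity at the point in question is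
asked, since `π(df, dg)` depends only on first derivatives. -/
def IsInducedBracket (π : CotangentBilinField I M)
    (B : C^∞⟮J, N; ℝ⟯ →ₗ[ℝ] C^∞⟮J, N; ℝ⟯ →ₗ[ℝ] C^∞⟮J, N; ℝ⟯) : Prop :=
  ∀ (F G : C^∞⟮J, N; ℝ⟯) (p : N) (f g : M → ℝ), IsHomogeneousExtensionAt Z ι F p f →
    IsHomogeneousExtensionAt Z ι G p g → B F G p = pairDiff π f g (ι p)

theorem exists_isInducedBracket {π : CotangentBilinField I M} (hπ : IsBivectorField π)
    (hι : ContMDiff J I ∞ ι) (htr : IsTransverseTo J ι Z)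
    (hext : HasHomogeneousExtensions J Z ι) :
    ∃ B : C^∞⟮J, N; ℝ⟯ →ₗ[ℝ] C^∞⟮J, N; ℝ⟯ →ₗ[ℝ] C^∞⟮J, N; ℝ⟯, IsInducedBracket Z ι π B := by
  choose α hα using fun p =>
    exists_linearMap_eq_mvfderiv hext htr ((hι p).mdifferentiableAt (by simp))
  let β : N → C^∞⟮J, N; ℝ⟯ →ₗ[ℝ] C^∞⟮J, N; ℝ⟯ →ₗ[ℝ] ℝ := fun p =>
    (π (ι p)).compl₁₂ (α p) (α p)
  have hβ : ∀ (F G : C^∞⟮J, N; ℝ⟯) (p : N) (f g : M → ℝ), IsHomogeneousExtensionAt Z ι F p f →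
      IsHomogeneousExtensionAt Z ι G p g → β p F G = pairDiff π f g (ι p) := by
    intro F G p f g hf hg
    rw [LinearMap.compl₁₂_apply, hα p F f hf, hα p G g hg, pairDiff]
  have hsmooth : ∀ F G, ContMDiff J 𝓘(ℝ, ℝ) ∞ fun p => β p F G := by
    intro F G p
    obtain ⟨f, hf⟩ := hext F p
    obtain ⟨g, hg⟩ := hext G p
    refine (((hπ.smooth f g).comp hι) p).congr_of_eventuallyEq ?_
    filter_upwards [hf.eventually, hg.eventually] with q hfq hgq
    exact hβ F G q f g hfq hgq
  exact ⟨LinearMap.mk₂ ℝ (fun F G => ⟨fun p => β p F G, hsmooth F G⟩)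
    (fun F F' G => ContMDiffMap.ext fun p => LinearMap.map_add₂ (β p) F F' G)
    (fun c F G => ContMDiffMap.ext fun p => LinearMap.map_smul₂ (β p) c F G)
    (fun F G G' => ContMDiffMap.ext fun p => map_add (β p F) G G')
    (fun c F G => ContMDiffMap.ext fun p => map_smul (β p F) c G), hβ⟩

namespace IsInducedBracket

variable {π : CotangentBilinField I M}
  {B : C^∞⟮J, N; ℝ⟯ →ₗ[ℝ] C^∞⟮J, N; ℝ⟯ →ₗ[ℝ] C^∞⟮J, N; ℝ⟯}

theorem sub_smul {π₁ π₂ : CotangentBilinField I M}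
    {B₁ B₂ : C^∞⟮J, N; ℝ⟯ →ₗ[ℝ] C^∞⟮J, N; ℝ⟯ →ₗ[ℝ] C^∞⟮J, N; ℝ⟯}
    (h₁ : IsInducedBracket Z ι π₁ B₁) (h₂ : IsInducedBracket Z ι π₂ B₂) (c : ℝ) :
    IsInducedBracket Z ι (π₁ - c • π₂) (B₁ - c • B₂) := by
  intro F G p f g hf hg
  rw [pairDiff_sub_smul, Pi.sub_apply, Pi.smul_apply, ← h₁ F G p f g hf hg,
    ← h₂ F G p f g hf hg]
  rfl

theorem localBracketEqOn (hB : IsInducedBracket Z ι π B) {U : Set M} {f g : M → ℝ}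
    (hf : ∀ x ∈ U, MDifferentiableAt I 𝓘(ℝ, ℝ) f x) (hg : ∀ x ∈ U, MDifferentiableAt I 𝓘(ℝ, ℝ) g x)
    (hZf : ∀ x ∈ U, derivAlong Z f x = f x) (hZg : ∀ x ∈ U, derivAlong Z g x = g x) :
    LocalBracketEqOn B (ι ⁻¹' U) (f ∘ ι) (g ∘ ι) (pairDiff π f g ∘ ι) :=
  fun p hp F G hF hG => hB F G p f g ⟨hf _ hp, hF.symm, hZf _ hp⟩ ⟨hg _ hp, hG.symm, hZg _ hp⟩

theorem skew (hB : IsInducedBracket Z ι π B) (hext : HasHomogeneousExtensions J Z ι)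
    (hπ : IsBivectorField π) (F G : C^∞⟮J, N; ℝ⟯) : B F G = -B G F := by
  ext p
  obtain ⟨f, hf⟩ := hext F p
  obtain ⟨g, hg⟩ := hext G p
  rw [ContMDiffMap.coe_neg, Pi.neg_apply,
    hB F G p f g hf.isHomogeneousExtensionAt hg.isHomogeneousExtensionAt,
    hB G F p g f hg.isHomogeneousExtensionAt hf.isHomogeneousExtensionAt, hπ.pairDiff_swap]

theorem tsupport_subset_left (hB : IsInducedBracket Z ι π B)
    (hext : HasHomogeneousExtensions J Z ι) (F G : C^∞⟮J, N; ℝ⟯) :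
    tsupport (B F G) ⊆ tsupport F := by
  intro p
  contrapose
  simp only [notMem_tsupport_iff_eventuallyEq]
  intro hF
  filter_upwards [hF.eventuallyEq_nhds] with q hFq
  obtain ⟨g, hg⟩ := hext G q
  rw [hB F G q 0 g (IsHomogeneousExtensionAt.zero.congr hFq.symm) hg.isHomogeneousExtensionAt]
  simp [pairDiff]

theorem tsupport_subset (hB : IsInducedBracket Z ι π B) (hext : HasHomogeneousExtensions J Z ι)
    (hπ : IsBivectorField π) (F G : C^∞⟮J, N; ℝ⟯) :
    tsupport (B F G) ⊆ tsupport F ∩ tsupport G := by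
  refine Set.subset_inter (hB.tsupport_subset_left hext F G) ?_
  rw [hB.skew hext hπ F G, ContMDiffMap.coe_neg, tsupport_neg]
  exact hB.tsupport_subset_left hext G F

theorem isHomogeneousExtensionAt_pairDiff (hB : IsInducedBracket Z ι π B)
    (hπ : IsBivectorField π) (hhom : IsHomogeneousWrt Z π) {F G : C^∞⟮J, N; ℝ⟯} {p : N}
    {f g : C^∞⟮I, M; ℝ⟯} (hf : IsSecondOrderHomogeneousExtensionAt Z ι F p f)
    (hg : IsSecondOrderHomogeneousExtensionAt Z ι G p g) :
    IsHomogeneousExtensionAt Z ι (B F G) p (pairDiff π f g) where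
  mdifferentiableAt := hπ.mdifferentiableAt_pairDiff f g _
  comp_eventuallyEq := by
    filter_upwards [hf.eventually, hg.eventually] with q hfq hgq
    exact (hB F G q f g hfq hgq).symm
  derivAlong_eq := by
    have h := hhom f g (ι p)
    rw [schoutenVector, pairDiff_congr π hf.mvfderiv_derivAlong rfl,
      pairDiff_congr π rfl hg.mvfderiv_derivAlong] at h
    linarith

theorem jacobi (hB : IsInducedBracket Z ι π B) (hext : HasHomogeneousExtensions J Z ι)
    (hπ : IsPoissonTensor π) (hhom : IsHomogeneousWrt Z π) (F G K : C^∞⟮J, N; ℝ⟯) :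
    B F (B G K) + B G (B K F) + B K (B F G) = 0 := by
  ext p
  have bracket_bracket : ∀ {F G K : C^∞⟮J, N; ℝ⟯} {f g k : C^∞⟮I, M; ℝ⟯},
      IsSecondOrderHomogeneousExtensionAt Z ι F p f →
      IsSecondOrderHomogeneousExtensionAt Z ι G p g →
      IsSecondOrderHomogeneousExtensionAt Z ι K p k →
      B F (B G K) p = -pairDiff π (pairDiff π g k) f (ι p) := by
    intro F G K f g k hf hg hk
    rw [hB F (B G K) p f _ hf.isHomogeneousExtensionAt
      (hB.isHomogeneousExtensionAt_pairDiff hπ.bivector hhom hg hk), hπ.bivector.pairDiff_swap]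
  obtain ⟨f, hf⟩ := hext F p
  obtain ⟨g, hg⟩ := hext G p
  obtain ⟨k, hk⟩ := hext K p
  have hS := hπ.schouten f g k (ι p)
  rw [schoutenSelf] at hS
  simp only [ContMDiffMap.coe_add, Pi.add_apply, ContMDiffMap.coe_zero, Pi.zero_apply,
    bracket_bracket hf hg hk, bracket_bracket hg hk hf, bracket_bracket hk hf hg]
  linarith

theorem isJacobiBracket (hB : IsInducedBracket Z ι π B) (hext : HasHomogeneousExtensions J Z ι)
    (hπ : IsPoissonTensor π) (hhom : IsHomogeneousWrt Z π) : IsJacobiBracket B where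
  skew := hB.skew hext hπ.bivector
  jacobi := hB.jacobi hext hπ hhom
  isLocal := hB.tsupport_subset hext hπ.bivector

end IsInducedBracket

theorem schoutenVector_sub_smul {π₁ π₂ : CotangentBilinField I M} (c : ℝ) {f g : M → ℝ} {x : M}
    (h₁ : MDifferentiableAt I 𝓘(ℝ, ℝ) (pairDiff π₁ f g) x)
    (h₂ : MDifferentiableAt I 𝓘(ℝ, ℝ) (pairDiff π₂ f g) x) :
    schoutenVector Z (π₁ - c • π₂) f g x =
      schoutenVector Z π₁ f g x - c * schoutenVector Z π₂ f g x := by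
  have hderiv : derivAlong Z (pairDiff π₁ f g - c • pairDiff π₂ f g) x =
      derivAlong Z (pairDiff π₁ f g) x - c * derivAlong Z (pairDiff π₂ f g) x := by
    rw [derivAlong, mvfderiv_sub h₁ (h₂.const_smul c), mvfderiv_const_smul h₂]
    rfl
  simp only [schoutenVector, pairDiff_sub_smul, hderiv, Pi.sub_apply, Pi.smul_apply, smul_eq_mul]
  ring

theorem IsHomogeneousPencil.left {π₁ π₂ : CotangentBilinField I M}
    (hhom : IsHomogeneousPencil Z π₁ π₂) : IsHomogeneousWrt Z π₁ := by
  have h : π₁ - (0 : ℝ) • π₂ = π₁ := by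
    rw [zero_smul]
    exact sub_zero π₁
  exact h ▸ hhom 0

theorem IsHomogeneousPencil.right {π₁ π₂ : CotangentBilinField I M}
    (hhom : IsHomogeneousPencil Z π₁ π₂) (h₁ : IsBivectorField π₁) (h₂ : IsBivectorField π₂) :
    IsHomogeneousWrt Z π₂ := by
  intro f g x
  have h := hhom 1 f g x
  rw [schoutenVector_sub_smul 1 (h₁.mdifferentiableAt_pairDiff f g x)
    (h₂.mdifferentiableAt_pairDiff f g x), hhom.left f g x, pairDiff_sub_smul, Pi.sub_apply,
    Pi.smul_apply, smul_eq_mul] at h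
  linarith

end InducedBracket

theorem mainTheorem5_general
    {E : Type*} [NormedAddCommGroup E] [NormedSpace ℝ E] [FiniteDimensional ℝ E]
    {H : Type*} [TopologicalSpace H] {I : ModelWithCorners ℝ E H}
    {M : Type*} [TopologicalSpace M] [T2Space M] [ChartedSpace H M] [IsManifold I ∞ M]
    {E' : Type*} [NormedAddCommGroup E'] [NormedSpace ℝ E']
    {H' : Type*} [TopologicalSpace H'] {J : ModelWithCorners ℝ E' H'} [J.Boundaryless]
    {N : Type*} [TopologicalSpace N] [ChartedSpace H' N]
    (hdim : Module.finrank ℝ E' < Module.finrank ℝ E)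
    {Z : ∀ x : M, TangentSpace I x}
    (hZ : ContMDiff I I.tangent ∞ (fun x => (⟨x, Z x⟩ : TangentBundle I M)))
    {π₁ π₂ : CotangentBilinField I M}
    (hπ : IsPoissonPencil π₁ π₂) (hhom : IsHomogeneousPencil Z π₁ π₂)
    {ι : N → M} (hι : Manifold.IsImmersion J I ∞ ι) (htr : IsTransverseTo J ι Z) :
    ∃ B₁ B₂ : C^∞⟮J, N; ℝ⟯ →ₗ[ℝ] C^∞⟮J, N; ℝ⟯ →ₗ[ℝ] C^∞⟮J, N; ℝ⟯,
      IsJacobiPencil B₁ B₂ ∧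
      ∀ (U : Set M), IsOpen U → ∀ f g : M → ℝ,
        ContMDiffOn I 𝓘(ℝ, ℝ) ∞ f U → ContMDiffOn I 𝓘(ℝ, ℝ) ∞ g U →
        (∀ x ∈ U, derivAlong Z f x = f x) → (∀ x ∈ U, derivAlong Z g x = g x) →
        ∀ c : ℝ, LocalBracketEqOn (B₁ - c • B₂) (ι ⁻¹' U) (f ∘ ι) (g ∘ ι)
          (pairDiff (π₁ - c • π₂) f g ∘ ι) := by
  have hext := hasHomogeneousExtensions_of_isImmersion hZ hι hdim htr
  have hhom₂ := hhom.right hπ.left.bivector hπ.right.bivector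
  obtain ⟨B₁, h₁⟩ := exists_isInducedBracket hπ.left.bivector hι.contMDiff htr hext
  obtain ⟨B₂, h₂⟩ := exists_isInducedBracket hπ.right.bivector hι.contMDiff htr hext
  refine ⟨B₁, B₂, ⟨h₁.isJacobiBracket hext hπ.left hhom.left,
    h₂.isJacobiBracket hext hπ.right hhom₂,
    fun c => (h₁.sub_smul h₂ c).isJacobiBracket hext (hπ.pencil c) (hhom c)⟩, ?_⟩
  intro U hU f g hf hg hZf hZg c
  have hdiff : ∀ {f : M → ℝ}, ContMDiffOn I 𝓘(ℝ, ℝ) ∞ f U →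
      ∀ x ∈ U, MDifferentiableAt I 𝓘(ℝ, ℝ) f x := fun hf x hx =>
    (hf.contMDiffAt (hU.mem_nhds hx)).mdifferentiableAt (by simp)
  exact (h₁.sub_smul h₂ c).localBracketEqOn (hdiff hf) (hdiff hg) hZf hZg

theorem mainTheorem5 (n : ℕ)
    {M : Type*} [TopologicalSpace M] [T2Space M]
    [ChartedSpace (EuclideanSpace ℝ (Fin (n + 1))) M] [IsManifold (𝓡 (n + 1)) ∞ M]
    {N : Type*} [TopologicalSpace N] [T2Space N]
    [ChartedSpace (EuclideanSpace ℝ (Fin n)) N] [IsManifold (𝓡 n) ∞ N]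
    (Z : ∀ x : M, TangentSpace (𝓡 (n + 1)) x)
    (hZ : ContMDiff (𝓡 (n + 1)) (𝓡 (n + 1)).tangent ∞
      (fun x => (⟨x, Z x⟩ : TangentBundle (𝓡 (n + 1)) M)))
    (π₁ π₂ : CotangentBilinField (𝓡 (n + 1)) M)
    (hπ : IsPoissonPencil π₁ π₂) (hhom : IsHomogeneousPencil Z π₁ π₂)
    (ι : N → M) (hι : Manifold.IsImmersion (𝓡 n) (𝓡 (n + 1)) ∞ ι) (hinj : Function.Injective ι)
    (htr : IsTransverseTo (𝓡 n) ι Z) :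
    ∃ B₁ B₂ : C^∞⟮𝓡 n, N; ℝ⟯ →ₗ[ℝ] C^∞⟮𝓡 n, N; ℝ⟯ →ₗ[ℝ] C^∞⟮𝓡 n, N; ℝ⟯,
      IsJacobiPencil B₁ B₂ ∧
      ∀ (U : Set M), IsOpen U → ∀ f g : M → ℝ,
        ContMDiffOn (𝓡 (n + 1)) 𝓘(ℝ, ℝ) ∞ f U → ContMDiffOn (𝓡 (n + 1)) 𝓘(ℝ, ℝ) ∞ g U →
        (∀ x ∈ U, derivAlong Z f x = f x) → (∀ x ∈ U, derivAlong Z g x = g x) →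
        ∀ c : ℝ, LocalBracketEqOn (B₁ - c • B₂) (ι ⁻¹' U) (f ∘ ι) (g ∘ ι)
          (pairDiff (π₁ - c • π₂) f g ∘ ι) :=
  mainTheorem5_general (by simp) hZ hπ hhom hι htr
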